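/- Let $P=(X,\prec)$ be a finite partially ordered set with $|X|=n>2$ elements. For a finite poset $Q$ with $m$ elements, let $e(Q)$ denote the number of linear extensions of $Q$, i.e. of bijections $f$ from $Q$ to $\{1,\dots,m\}$ such that $u\prec v$ implies $f(u)<f(v)$. For elements $x,y\in X$, let $P-x$, $P-y$ and $P-x-y$ denote the induced subposets of $P$ on $X\setminus\{x\}$, $X\setminus\{y\}$ and $X\setminus\{x,y\}$. If $x,y$ are distinct minimal elements of $P$, then $$\frac{n}{n-1}\ \le\ \frac{e(P)\cdot e(P-x-y)}{e(P-x)\cdot e(P-y)}\ \le\ 2.$$ -/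

import Mathlib

/-- A linear extension of a finite poset `α` with `n` elements: an order-preserving bijection
from `α` onto the `n`-element chain, written here as `Fin n = {0, …, n - 1}` (that is, the labels
`1, …, n` are shifted by one). -/
abbrev LinExt (α : Type*) [PartialOrder α] : Type _ :=
  {f : α ≃ Fin (Nat.card α) // StrictMono f}

/-- `e(P)`, the number of linear extensions of a finite poset. -/
noncomputable def numLinExt (α : Type*) [PartialOrder α] : ℕ :=
  Nat.card (LinExt α)

/-! The two bounds have unrelated proofs. Upper bound: on the minimal elements of a subposet `S`,
consider the symmetric matrix counting linear extensions by their first two elements. A second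
element that becomes minimal only after removing `x` is identified with `x`, so it contributes to
the diagonal. Row sums are `e(S - x)` and, when `|S| ≥ 2`, the total is `e(S)`. This matrix is
hyperbolic: `⟨f, Mf⟩⟨1, M1⟩ ≤ ⟨1, Mf⟩²` (`linkForm_mul_le_sq`). A test vector supported on the two
given elements then yields the factor 2. Hyperbolicity is proved by induction on `S`: the form of
`S` is at most the sum of the forms of all `S - x` (`linkForm_le_sum_contract`). Their hyperbolicity
bounds this by `∑ (Mf)_x² / d_x`, where `d_x` is the row sum. That inequality forces every positive
eigenvalue of `D⁻¹M` to be at least 1, which leaves only the constants (`quadForm_mul_le_sq`). Lower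
bound: monotone maps to an `N`-chain number about `e(Q) N^m / m!`. In a random map, the constraints
at the two minimal elements are positively correlated by FKG (`card_monotoneOn_mul_le`); letting `N
→ ∞`, the factorials give `n / (n - 1)`. -/

/-! ### Spectral criterion for hyperbolicity -/

open Finset in
theorem eigenvalue_nonpos_or_const {I : Type*} [Fintype I] (M : Matrix I I ℝ) (d : I → ℝ)
    (hsymm : M.IsSymm) (hnn : ∀ i j, 0 ≤ M i j) (hoff : ∀ i j, i ≠ j → 0 < M i j)
    (hd : ∀ i, 0 < d i) (hrow : ∀ i, ∑ j, M i j = d i)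
    (hpull : ∀ f : I → ℝ, ∑ i, f i * (M.mulVec f) i ≤ ∑ i, (M.mulVec f) i ^ 2 / d i)
    (g : I → ℝ) (c : ℝ) (hg : ∀ i, (M.mulVec g) i = c * (d i * g i)) :
    c ≤ 0 ∨ ∀ i j, g i = g j := by
  by_cases hc : c ≤ 0
  · exact Or.inl hc
  right
  push Not at hc
  have h1 := hpull g
  have e1 : ∑ i, g i * (M.mulVec g) i = c * ∑ i, d i * g i ^ 2 := by
    rw [mul_sum]; exact sum_congr rfl fun i _ => by rw [hg]; ring
  have e2 : ∑ i, (M.mulVec g) i ^ 2 / d i = c * (c * ∑ i, d i * g i ^ 2) := by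
    rw [mul_sum, mul_sum]
    exact sum_congr rfl fun i _ => by rw [hg]; have := (hd i).ne'; field_simp
  rw [e2, e1] at h1
  -- For an eigenvector, `hpull` reads `c * ‖g‖² ≤ c² * ‖g‖²` in the `d`-weighted norm; dividing by
  -- `c > 0` gives this.
  have h2 : ∑ i, d i * g i ^ 2 ≤ ∑ i, g i * (M.mulVec g) i := by
    rw [e1]; exact le_of_mul_le_mul_left h1 hc
  -- The Dirichlet form of `D - M`. It is nonnegative, so `h2` makes it vanish, and positive
  -- off-diagonal weights make `g` constant.
  have e3 : ∑ i, ∑ j, M i j * (g i - g j) ^ 2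
      = 2 * (∑ i, d i * g i ^ 2 - ∑ i, g i * (M.mulVec g) i) := by
    have a1 : ∑ i, ∑ j, M i j * g i ^ 2 = ∑ i, d i * g i ^ 2 :=
      sum_congr rfl fun i _ => by rw [← sum_mul, hrow]
    have a2 : ∑ i, ∑ j, M i j * g j ^ 2 = ∑ i, d i * g i ^ 2 := by
      rw [sum_comm, ← a1]
      exact sum_congr rfl fun i _ => sum_congr rfl fun j _ => by rw [hsymm.apply]
    have a3 : ∑ i, ∑ j, M i j * (g i * g j) = ∑ i, g i * (M.mulVec g) i :=
      sum_congr rfl fun i _ => by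
        rw [Matrix.mulVec, dotProduct, mul_sum]; exact sum_congr rfl fun j _ => by ring
    have : ∀ i j, M i j * (g i - g j) ^ 2
        = M i j * g i ^ 2 + M i j * g j ^ 2 - 2 * (M i j * (g i * g j)) := fun i j => by ring
    simp_rw [this, sum_sub_distrib, sum_add_distrib, ← mul_sum, a1, a2, a3]
    ring
  have hterm : ∀ i j, 0 ≤ M i j * (g i - g j) ^ 2 := fun i j => mul_nonneg (hnn i j) (sq_nonneg _)
  intro i j
  by_cases hij : i = j
  · rw [hij]
  have h3 : M i j * (g i - g j) ^ 2 ≤ 0 := by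
    calc M i j * (g i - g j) ^ 2 ≤ ∑ j, M i j * (g i - g j) ^ 2 :=
          single_le_sum (f := fun j => M i j * (g i - g j) ^ 2) (fun j _ => hterm i j) (mem_univ j)
      _ ≤ ∑ i, ∑ j, M i j * (g i - g j) ^ 2 :=
          single_le_sum (f := fun i => ∑ j, M i j * (g i - g j) ^ 2)
            (fun i _ => sum_nonneg fun j _ => hterm i j) (mem_univ i)
      _ ≤ 0 := by rw [e3]; linarith
  have h4 : (g i - g j) ^ 2 ≤ 0 := by
    by_contra h; push Not at h
    exact absurd (mul_pos (hoff i j hij) h) (not_lt.2 h3)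
  have := pow_eq_zero_iff (two_ne_zero) |>.1 (le_antisymm h4 (sq_nonneg _))
  linarith

-- Diagonalise the symmetric matrix `D^(-1/2) M D^(-1/2)`: an eigenvector with positive eigenvalue
-- corresponds to a constant function, and `hf` is orthogonality to the constants in the
-- `d`-weighted inner product.
open Finset in
theorem quadForm_nonpos_of_orthogonal {I : Type*} [Fintype I] (M : Matrix I I ℝ) (d : I → ℝ)
    (hsymm : M.IsSymm) (hnn : ∀ i j, 0 ≤ M i j) (hoff : ∀ i j, i ≠ j → 0 < M i j)
    (hd : ∀ i, 0 < d i) (hrow : ∀ i, ∑ j, M i j = d i)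
    (hpull : ∀ f : I → ℝ, ∑ i, f i * (M.mulVec f) i ≤ ∑ i, (M.mulVec f) i ^ 2 / d i)
    (f : I → ℝ) (hf : ∑ i, d i * f i = 0) :
    ∑ i, f i * (M.mulVec f) i ≤ 0 := by
  classical
  have hs : ∀ i, 0 < √(d i) := fun i => Real.sqrt_pos.2 (hd i)
  have hss : ∀ i, √(d i) * √(d i) = d i := fun i => Real.mul_self_sqrt (hd i).le
  let N : Matrix I I ℝ := Matrix.of fun i j => M i j / (√(d i) * √(d j))
  have hN : N.IsHermitian := by
    ext i j
    simp only [N, Matrix.conjTranspose_apply, Matrix.of_apply, star_trivial]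
    rw [hsymm.apply, mul_comm]
  have hNM : ∀ (u : I → ℝ) i, (M.mulVec fun j => u j / √(d j)) i = √(d i) * (N.mulVec u) i := by
    intro u i
    simp only [Matrix.mulVec, dotProduct, N, Matrix.of_apply, mul_sum]
    exact sum_congr rfl fun j _ => by have := (hs i).ne'; have := (hs j).ne'; field_simp
  let u : I → ℝ := fun i => √(d i) * f i
  have hu : (fun j => u j / √(d j)) = f := by
    funext j; have := (hs j).ne'; simp only [u]; field_simp
  have e1 : ∑ i, f i * (M.mulVec f) i = ∑ i, u i * (N.mulVec u) i := by
    refine sum_congr rfl fun i _ => ?_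
    have := hNM u i
    rw [hu] at this
    rw [this]; simp only [u]; ring
  let b := hN.eigenvectorBasis
  let U : EuclideanSpace ℝ I := WithLp.toLp 2 u
  let V : EuclideanSpace ℝ I := WithLp.toLp 2 (N.mulVec u)
  have e2 : ∑ i, u i * (N.mulVec u) i = inner ℝ U V := by
    simp [U, V, PiLp.inner_apply, mul_comm]
  -- Each product is the eigenvalue times a squared coefficient of `U`: either the eigenvalue is
  -- nonpositive or the coefficient is zero.
  have hkey : ∀ k, inner ℝ U (b k) * inner ℝ (b k) V ≤ 0 := by
    intro k
    have hev : N.mulVec (b k).ofLp = hN.eigenvalues k • (b k).ofLp := hN.mulVec_eigenvectorBasis k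
    have h1 : inner ℝ (b k) V = hN.eigenvalues k * inner ℝ U (b k) := by
      have a1 : inner ℝ (b k) V = (b k).ofLp ⬝ᵥ N.mulVec u := by
        simp [V, PiLp.inner_apply, dotProduct, mul_comm]
      have a2 : inner ℝ U (b k) = (b k).ofLp ⬝ᵥ u := by
        simp [U, PiLp.inner_apply, dotProduct]
      have hNt : N.transpose = N := by
        have := hN; rwa [Matrix.IsHermitian, Matrix.conjTranspose_eq_transpose_of_trivial] at this
      rw [a1, a2, Matrix.dotProduct_mulVec, ← Matrix.mulVec_transpose, hNt, hev, smul_dotProduct,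
        smul_eq_mul]
    have h2 := eigenvalue_nonpos_or_const M d hsymm hnn hoff hd hrow hpull
      (fun j => (b k).ofLp j / √(d j)) (hN.eigenvalues k) (by
        intro i
        rw [hNM, hev]
        simp only [Pi.smul_apply, smul_eq_mul]
        have := (hs i).ne'
        nth_rw 2 [← hss i]
        field_simp)
    rw [h1]
    rcases h2 with h2 | h2
    · have := mul_nonneg (neg_nonneg.2 h2) (mul_self_nonneg (inner ℝ U (b k)))
      linarith
    · have h0 : inner ℝ U (b k) = 0 := by
        rcases isEmpty_or_nonempty I with hI | ⟨⟨i0⟩⟩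
        · simp [PiLp.inner_apply]
        · have : ∀ i, (b k).ofLp i = √(d i) * ((b k).ofLp i0 / √(d i0)) := by
            intro i
            rw [← h2 i i0]; have := (hs i).ne'; field_simp
          have a2 : inner ℝ U (b k) = ∑ i, u i * (b k).ofLp i := by
            simp [U, PiLp.inner_apply, mul_comm]
          rw [a2, ← zero_mul ((b k).ofLp i0 / √(d i0)), ← hf, sum_mul]
          refine sum_congr rfl fun i _ => ?_
          rw [this i]
          simp only [u]
          linear_combination (f i * ((b k).ofLp i0 / √(d i0))) * hss i
      simp [h0]
  rw [e1, e2, ← b.sum_inner_mul_inner U V]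
  exact sum_nonpos fun k _ => hkey k

open Finset in
theorem quadForm_mul_le_sq {I : Type*} [Fintype I] (M : Matrix I I ℝ) (d : I → ℝ)
    (hsymm : M.IsSymm) (hnn : ∀ i j, 0 ≤ M i j) (hoff : ∀ i j, i ≠ j → 0 < M i j)
    (hd : ∀ i, 0 < d i) (hrow : ∀ i, ∑ j, M i j = d i)
    (hpull : ∀ f : I → ℝ, ∑ i, f i * (M.mulVec f) i ≤ ∑ i, (M.mulVec f) i ^ 2 / d i)
    (hpos : 0 < ∑ i, d i) (f : I → ℝ) :
    (∑ i, f i * (M.mulVec f) i) * ∑ i, d i ≤ (∑ i, d i * f i) ^ 2 := by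
  set s := ∑ i, d i with hs
  set t := ∑ i, d i * f i with ht
  -- The `d`-weighted mean of `f`; subtracting it lands in the orthogonal complement of the
  -- constants.
  set c := t / s with hc
  have hcs : c * s = t := div_mul_cancel₀ _ hpos.ne'
  have h1 : ∑ i, d i * (f i - c) = 0 := by
    simp_rw [mul_sub, sum_sub_distrib, ← sum_mul]
    rw [← ht, ← hs]; linarith
  have h2 := quadForm_nonpos_of_orthogonal M d hsymm hnn hoff hd hrow hpull (fun i => f i - c) h1
  have h3 : ∀ i, (M.mulVec fun i => f i - c) i = (M.mulVec f) i - c * d i := by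
    intro i
    simp only [Matrix.mulVec, dotProduct, mul_sub, sum_sub_distrib, ← sum_mul, hrow]
    ring
  have h4 : ∑ i, (M.mulVec f) i = t := by
    simp only [Matrix.mulVec, dotProduct]
    rw [sum_comm, ht]
    refine sum_congr rfl fun i _ => ?_
    rw [← sum_mul, ← hrow i]
    congr 1
    exact sum_congr rfl fun j _ => hsymm.apply _ _
  have h5 : ∑ i, (f i - c) * ((M.mulVec f) i - c * d i)
      = ∑ i, f i * (M.mulVec f) i - c * t - c * t + c * c * s := by
    have : ∀ i, (f i - c) * ((M.mulVec f) i - c * d i)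
        = f i * (M.mulVec f) i - c * (d i * f i) - c * (M.mulVec f) i + c * c * d i :=
      fun i => by ring
    simp_rw [this, sum_add_distrib, sum_sub_distrib, ← mul_sum]
    rw [h4, ← ht, ← hs]
  simp_rw [h3] at h2
  rw [h5, mul_assoc c c s, hcs] at h2
  have h6 : c * t * s = t ^ 2 := by rw [mul_right_comm, hcs]; ring
  nlinarith

/-! ### The three-element inequality -/

-- This is the local inequality behind `linkForm_le_sum_contract`. Read `x0`, `xy`, `xyz` as
-- minimality of `x` in `S`, `S - y`, `S - y - z`, and `a`, `b`, `c` as the values of `f` at `x`,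
-- `y`, `z`. Each summand is one order of removing the three elements.
set_option maxHeartbeats 2000000 in
theorem perm_sum_nonneg (x0 y0 z0 xy xz yx yz zx zy xyz yxz zxy : Prop)
    [Decidable x0] [Decidable y0] [Decidable z0] [Decidable xy] [Decidable xz] [Decidable yx]
    [Decidable yz] [Decidable zx] [Decidable zy] [Decidable xyz] [Decidable yxz] [Decidable zxy]
    (a b c : ℝ)
    (hx : (x0 → xy ∧ xz) ∧ (xy → xyz) ∧ (xz → xyz) ∧ (xy → xz → x0))
    (hy : (y0 → yx ∧ yz) ∧ (yx → yxz) ∧ (yz → yxz) ∧ (yx → yz → y0))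
    (hz : (z0 → zx ∧ zy) ∧ (zx → zxy) ∧ (zy → zxy) ∧ (zx → zy → z0)) :
    let L (a b c : ℝ) (y0 z0 zx : Prop) [Decidable y0] [Decidable z0] [Decidable zx] : ℝ :=
      (if y0 then b else a) * (if zx then if z0 then c else a else if y0 then b else a)
        - a * (if y0 then b else a)
    0 ≤ (if x0 ∧ yx ∧ zxy then L a b c y0 z0 zx else 0)
      + (if x0 ∧ zx ∧ yxz then L a c b z0 y0 yx else 0)
      + (if y0 ∧ xy ∧ zxy then L b a c x0 z0 zy else 0)
      + (if y0 ∧ zy ∧ xyz then L b c a z0 x0 xy else 0)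
      + (if z0 ∧ xz ∧ yxz then L c a b x0 y0 yz else 0)
      + (if z0 ∧ yz ∧ xyz then L c b a y0 x0 xz else 0) := by
  -- Only five patterns are consistent for each element: it is blocked by neither of the other two,
  -- by exactly one, by both, or by something outside the triple.
  have key : ∀ p0 p1 p2 p3 : Prop, ((p0 → p1 ∧ p2) ∧ (p1 → p3) ∧ (p2 → p3) ∧ (p1 → p2 → p0)) →
      (p0 ∧ p1 ∧ p2 ∧ p3) ∨ (¬ p0 ∧ p1 ∧ ¬ p2 ∧ p3) ∨ (¬ p0 ∧ ¬ p1 ∧ p2 ∧ p3) ∨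
      (¬ p0 ∧ ¬ p1 ∧ ¬ p2 ∧ p3) ∨ (¬ p0 ∧ ¬ p1 ∧ ¬ p2 ∧ ¬ p3) := by
    intro p0 p1 p2 p3 h
    by_cases h1 : p1 <;> by_cases h2 : p2 <;> by_cases h3 : p3 <;> by_cases h0 : p0 <;>
      simp only [h0, h1, h2, h3, not_true, not_false_iff, true_imp_iff, false_imp_iff, or_true,
        or_false, and_true, and_self, and_false, imp_false] at h ⊢
  intro L
  have kx := key _ _ _ _ hx
  have ky := key _ _ _ _ hy
  have kz := key _ _ _ _ hz
  clear hx hy hz key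
  rcases kx with ⟨h0, h1, h2, h3⟩ | ⟨h0, h1, h2, h3⟩ | ⟨h0, h1, h2, h3⟩ |
    ⟨h0, h1, h2, h3⟩ | ⟨h0, h1, h2, h3⟩ <;>
  simp only [L, h0, h1, h2, h3, if_true, if_false, and_true,
    and_false, true_and, false_and, add_zero, zero_add] <;> clear h0 h1 h2 h3 L <;>
  rcases ky with ⟨h0, h1, h2, h3⟩ | ⟨h0, h1, h2, h3⟩ | ⟨h0, h1, h2, h3⟩ |
    ⟨h0, h1, h2, h3⟩ | ⟨h0, h1, h2, h3⟩ <;>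
  simp only [h0, h1, h2, h3, if_true, if_false, and_true,
    and_false, true_and, false_and, add_zero, zero_add, le_refl] <;> clear h0 h1 h2 h3 <;>
  rcases kz with ⟨h0, h1, h2, h3⟩ | ⟨h0, h1, h2, h3⟩ | ⟨h0, h1, h2, h3⟩ |
    ⟨h0, h1, h2, h3⟩ | ⟨h0, h1, h2, h3⟩ <;>
  simp only [h0, h1, h2, h3, if_true, if_false, add_zero, le_refl, sub_self] <;> 
  linarith [sq_nonneg (a - b), sq_nonneg (a - c), sq_nonneg (b - c)]

/-! ### Linear extensions by first element -/

theorem numLinExt_eq_card {α : Type*} [PartialOrder α] {m : ℕ} (h : Nat.card α = m) :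
    numLinExt α = Nat.card {f : α ≃ Fin m // StrictMono f} := by
  subst h; rfl

theorem numLinExt_congr {α β : Type*} [PartialOrder α] [PartialOrder β] (e : α ≃o β) :
    numLinExt α = numLinExt β := by
  rw [numLinExt_eq_card (Nat.card_congr e.toEquiv)]
  refine Nat.card_congr
    { toFun := fun f => ⟨e.symm.toEquiv.trans f.1, f.2.comp e.symm.strictMono⟩
      invFun := fun f => ⟨e.toEquiv.trans f.1, f.2.comp e.strictMono⟩
      left_inv := fun f => by ext; simp
      right_inv := fun f => by ext; simp }

section MinElems

variable {X : Type*} [PartialOrder X]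

open Classical in
/-- The minimal elements of the subposet `S`. -/
noncomputable def minElems (S : Finset X) : Finset X := {x ∈ S | ∀ u ∈ S, ¬ u < x}

theorem mem_minElems {S : Finset X} {x : X} :
    x ∈ minElems S ↔ x ∈ S ∧ ∀ u ∈ S, ¬ u < x := by
  simp [minElems]

theorem minElems_subset (S : Finset X) : minElems S ⊆ S := fun _ h => (mem_minElems.1 h).1

theorem minElems_nonempty {S : Finset X} (hS : S.Nonempty) : (minElems S).Nonempty := by
  obtain ⟨m, hm⟩ := S.exists_minimal hS
  exact ⟨m, mem_minElems.2 ⟨hm.prop, fun u hu h => (hm.not_lt hu) h⟩⟩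

/-- The number of linear extensions of the subposet `S`, as a real number. -/
noncomputable def extCount (S : Finset X) : ℝ := numLinExt {z : X // z ∈ S}

theorem extCount_nonneg (S : Finset X) : 0 ≤ extCount S := Nat.cast_nonneg _

theorem extCount_empty : extCount (∅ : Finset X) = 1 := by
  have : Nat.card {z : X // z ∈ (∅ : Finset X)} = 0 := by simp
  rw [extCount, numLinExt_eq_card this]
  have : Unique {f : {z : X // z ∈ (∅ : Finset X)} ≃ Fin 0 // StrictMono f} :=
    { default := ⟨Equiv.equivOfIsEmpty _ _, fun a => isEmptyElim a⟩
      uniq := fun f => Subtype.ext (Equiv.ext fun a => isEmptyElim a) }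
  simp

variable [DecidableEq X]

/-- Deleting the bottom element `x` and lowering the other labels by one is a bijection; minimality
of `x` is what lets it be put back at label `0`. -/
theorem card_linExt_fiber {S : Finset X} {m : ℕ} (hm : S.card = m + 1) {x : X}
    (hx : x ∈ minElems S) :
    Nat.card {f : {f : {z : X // z ∈ S} ≃ Fin (m + 1) // StrictMono f} //
        ((f.1.symm 0 : {z : X // z ∈ S}) : X) = x} =
      Nat.card {f : {z : X // z ∈ S.erase x} ≃ Fin m // StrictMono f} := by
  have hxS := minElems_subset S hx
  have hcard : Fintype.card {z : X // z ∈ S.erase x} = Fintype.card (Fin m) := by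
    simp [Finset.card_erase_of_mem hxS, hm]
  have hcard' : Fintype.card {z : X // z ∈ S} = Fintype.card (Fin (m + 1)) := by
    simp [hm]
  have hne : ∀ f : {f : {f : {z : X // z ∈ S} ≃ Fin (m + 1) // StrictMono f} //
      ((f.1.symm 0 : {z : X // z ∈ S}) : X) = x}, ∀ z : {z : X // z ∈ S.erase x},
      f.1.1 ⟨z, Finset.mem_of_mem_erase z.2⟩ ≠ 0 := by
    intro f z h
    have h2 := f.2
    have h3 : f.1.1.symm 0 = ⟨z, Finset.mem_of_mem_erase z.2⟩ := by
      rw [Equiv.symm_apply_eq, h]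
    rw [h3] at h2
    exact Finset.ne_of_mem_erase z.2 h2
  let ext : ({z : X // z ∈ S.erase x} ≃ Fin m) → {z : X // z ∈ S} → Fin (m + 1) := fun g z =>
    if h : (z : X) = x then 0 else (g ⟨z, Finset.mem_erase.2 ⟨h, z.2⟩⟩).succ
  have hext : ∀ g, Function.Injective (ext g) := by
    intro g a b hab
    simp only [ext] at hab
    split_ifs at hab with h1 h2 h2
    · exact Subtype.ext (h1.trans h2.symm)
    · exact absurd hab.symm (Fin.succ_ne_zero _)
    · exact absurd hab (Fin.succ_ne_zero _)
    · have := g.injective (Fin.succ_injective _ hab)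
      exact Subtype.ext (Subtype.mk.inj this)
  refine Nat.card_congr
    { toFun := fun f => ⟨Equiv.ofBijective
        (fun z => (f.1.1 ⟨z, Finset.mem_of_mem_erase z.2⟩).pred (hne f z))
        ((Fintype.bijective_iff_injective_and_card _).2 ⟨?_, hcard⟩), ?_⟩
      invFun := fun g => ⟨⟨Equiv.ofBijective (ext g.1)
        ((Fintype.bijective_iff_injective_and_card _).2 ⟨hext g.1, hcard'⟩), ?_⟩, ?_⟩
      left_inv := ?_
      right_inv := ?_ }
  · intro a b hab
    have := f.1.1.injective (Fin.pred_inj.1 hab)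
    exact Subtype.ext (Subtype.mk.inj this)
  · intro a b hab
    simp only [Equiv.ofBijective_apply]
    rw [Fin.pred_lt_pred_iff]
    exact f.1.2 hab
  · intro a b hab
    show ext g.1 a < ext g.1 b
    simp only [ext]
    have hb : (b : X) ≠ x := fun h => (mem_minElems.1 hx).2 a a.2 (h ▸ hab)
    rw [dif_neg hb]
    split_ifs with h1
    · exact Fin.succ_pos _
    · exact Fin.succ_lt_succ_iff.2 (g.2 hab)
  · have : (Equiv.ofBijective (ext g.1)
        ((Fintype.bijective_iff_injective_and_card _).2 ⟨hext g.1, hcard'⟩)).symm 0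
        = ⟨x, hxS⟩ := by
      rw [Equiv.symm_apply_eq]; simp [ext]
    simp only [this]
  · intro f
    ext z
    simp only [Equiv.ofBijective_apply, ext]
    split_ifs with h
    · have h2 : f.1.1.symm 0 = z := Subtype.ext (f.2.trans h.symm)
      rw [Equiv.symm_apply_eq] at h2
      rw [← h2]
    · simp
  · intro g
    ext z
    have hz : (z : X) ≠ x := Finset.ne_of_mem_erase z.2
    simp [ext, hz]

theorem extCount_eq_sum {S : Finset X} (hS : S.Nonempty) :
    extCount S = ∑ x ∈ minElems S, extCount (S.erase x) := by
  obtain ⟨m, hm⟩ : ∃ m, S.card = m + 1 :=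
    ⟨S.card - 1, by have := Finset.card_pos.2 hS; omega⟩
  have h1 : Nat.card {z : X // z ∈ S} = m + 1 := by simp [hm]
  simp only [extCount]
  rw [numLinExt_eq_card h1, ← Nat.cast_sum]
  congr 1
  classical
  let G := {f : {z : X // z ∈ S} ≃ Fin (m + 1) // StrictMono f}
  have : Fintype G := Fintype.ofFinite G
  rw [Nat.card_eq_fintype_card, ← Finset.card_univ,
    Finset.card_eq_sum_card_fiberwise (f := fun f : G => ((f.1.symm 0 : {z : X // z ∈ S}) : X))
      (t := minElems S)]
  · refine Finset.sum_congr rfl fun x hx => ?_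
    have h2 : Nat.card {z : X // z ∈ S.erase x} = m := by
      rw [Nat.card_eq_fintype_card, Fintype.card_coe,
        Finset.card_erase_of_mem (minElems_subset S hx), hm]
      rfl
    rw [numLinExt_eq_card h2, ← card_linExt_fiber hm hx, Nat.card_eq_fintype_card,
      Fintype.card_subtype]
  · intro f _
    refine mem_minElems.2 ⟨Subtype.prop _, fun u hu h => ?_⟩
    have h3 : f.1 ⟨u, hu⟩ < f.1 (f.1.symm 0) := f.2 h
    simp at h3

theorem extCount_pos (S : Finset X) : 0 < extCount S := by
  induction S using Finset.strongInduction with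
  | H S ih =>
    rcases S.eq_empty_or_nonempty with rfl | hS
    · rw [extCount_empty]; exact one_pos
    · rw [extCount_eq_sum hS]
      exact Finset.sum_pos (fun x hx => ih _ (Finset.erase_ssubset (minElems_subset S hx)))
        (minElems_nonempty hS)

end MinElems

/-! ### Hyperbolicity of the first-two-elements form, and the upper bound -/

section LinkForm

variable {X : Type*} [PartialOrder X] [DecidableEq X]

open Finset

/-- Pull a function on `minElems S` back to `minElems (S.erase x)`: the elements that become
minimal when `x` is removed are sent to `x`. -/
noncomputable def contract (S : Finset X) (x : X) (f : X → ℝ) (y : X) : ℝ :=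
  if y ∈ minElems S then f y else f x

/-- The action of the matrix counting linear extensions by their first two elements. -/
noncomputable def linkOp (S : Finset X) (f : X → ℝ) (x : X) : ℝ :=
  ∑ y ∈ minElems (S.erase x), extCount ((S.erase x).erase y) * contract S x f y

noncomputable def linkForm (S : Finset X) (f : X → ℝ) : ℝ :=
  ∑ x ∈ minElems S, f x * linkOp S f x

theorem self_notMem_minElems_erase (S : Finset X) (x : X) : x ∉ minElems (S.erase x) :=
  fun h => notMem_erase x S (minElems_subset _ h)

theorem self_notMem_minElems_erase_erase (S : Finset X) (x y : X) :
    x ∉ minElems ((S.erase x).erase y) :=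
  fun h => notMem_erase x S (mem_of_mem_erase (minElems_subset _ h))

theorem mem_minElems_erase {S : Finset X} {x y : X} (hxy : x ≠ y) (hx : x ∈ minElems S) :
    x ∈ minElems (S.erase y) := by
  rw [mem_minElems] at *
  exact ⟨mem_erase.2 ⟨hxy, hx.1⟩, fun u hu => hx.2 u (mem_of_mem_erase hu)⟩

theorem mem_minElems_of_erase_erase {S : Finset X} {x y z : X} (hyz : y ≠ z)
    (hy : x ∈ minElems (S.erase y)) (hz : x ∈ minElems (S.erase z)) : x ∈ minElems S := by
  rw [mem_minElems] at *
  refine ⟨mem_of_mem_erase hy.1, fun u hu => ?_⟩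
  by_cases h : u = y
  · exact hz.2 u (mem_erase.2 ⟨h ▸ hyz, hu⟩)
  · exact hy.2 u (mem_erase.2 ⟨h, hu⟩)

omit [DecidableEq X] in
theorem minElems_singleton (x : X) : minElems ({x} : Finset X) = {x} := by
  ext y
  rw [mem_minElems]
  constructor
  · exact fun h => h.1
  · intro h
    refine ⟨h, fun u hu => ?_⟩
    rw [mem_singleton] at h hu
    rw [h, hu]; exact lt_irrefl x

theorem extCount_singleton (x : X) : extCount ({x} : Finset X) = 1 := by
  rw [extCount_eq_sum (singleton_nonempty x), minElems_singleton, sum_singleton,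
    erase_singleton, extCount_empty]

omit [PartialOrder X] in
theorem sum_eq_sum_ite {T S : Finset X} (h : T ⊆ S) (g : X → ℝ) :
    ∑ x ∈ T, g x = ∑ x ∈ S, if x ∈ T then g x else 0 := by
  rw [sum_ite_mem, inter_eq_right.2 h]

omit [PartialOrder X] [DecidableEq X] in
theorem sum_triple_nonneg (S : Finset X) (F : X → X → X → ℝ)
    (h : ∀ x y z, 0 ≤ F x y z + F x z y + F y x z + F y z x + F z x y + F z y x) :
    0 ≤ ∑ x ∈ S, ∑ y ∈ S, ∑ z ∈ S, F x y z := by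
  have h1 : 0 ≤ ∑ x ∈ S, ∑ y ∈ S, ∑ z ∈ S,
      (F x y z + F x z y + F y x z + F y z x + F z x y + F z y x) :=
    sum_nonneg fun x _ => sum_nonneg fun y _ => sum_nonneg fun z _ => h x y z
  simp_rw [sum_add_distrib] at h1
  have e1 : ∑ x ∈ S, ∑ y ∈ S, ∑ z ∈ S, F x z y = ∑ x ∈ S, ∑ y ∈ S, ∑ z ∈ S, F x y z :=
    sum_congr rfl fun x _ => sum_comm
  have e2 : ∑ x ∈ S, ∑ y ∈ S, ∑ z ∈ S, F y x z = ∑ x ∈ S, ∑ y ∈ S, ∑ z ∈ S, F x y z := sum_comm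
  have e3 : ∑ x ∈ S, ∑ y ∈ S, ∑ z ∈ S, F y z x = ∑ x ∈ S, ∑ y ∈ S, ∑ z ∈ S, F x y z := by
    rw [sum_comm]; exact sum_congr rfl fun x _ => sum_comm
  have e4 : ∑ x ∈ S, ∑ y ∈ S, ∑ z ∈ S, F z x y = ∑ x ∈ S, ∑ y ∈ S, ∑ z ∈ S, F x y z := by
    rw [← e2]
    exact sum_congr rfl fun x _ => sum_comm
  have e5 : ∑ x ∈ S, ∑ y ∈ S, ∑ z ∈ S, F z y x = ∑ x ∈ S, ∑ y ∈ S, ∑ z ∈ S, F x y z := by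
    rw [← e3]
    exact sum_congr rfl fun x _ => sum_comm
  rw [e1, e2, e3, e4, e5] at h1
  linarith

/-- Both sides expand over the first three elements `x, y, z` removed, with weight `extCount` of
what remains. That weight is independent of their order, so summing over the six orders reduces the
claim to `perm_sum_nonneg`. -/
theorem linkForm_le_sum_contract {S : Finset X} (hS : 3 ≤ S.card) (f : X → ℝ) :
    linkForm S f ≤ ∑ x ∈ minElems S, linkForm (S.erase x) (contract S x f) := by
  let D (x y z : X) : ℝ := extCount (((S.erase x).erase y).erase z) *
    (contract S x f y * contract (S.erase x) y (contract S x f) z - f x * contract S x f y)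
  let F (x y z : X) : ℝ :=
    if x ∈ minElems S ∧ y ∈ minElems (S.erase x) ∧ z ∈ minElems ((S.erase x).erase y)
      then D x y z else 0
  have hF : ∑ x ∈ minElems S, linkForm (S.erase x) (contract S x f) - linkForm S f
      = ∑ x ∈ S, ∑ y ∈ S, ∑ z ∈ S, F x y z := by
    rw [linkForm, ← sum_sub_distrib, sum_eq_sum_ite (minElems_subset S)]
    refine sum_congr rfl fun x _ => ?_
    by_cases hx : x ∈ minElems S
    swap
    · simp [F, hx]
    rw [if_pos hx, linkForm, linkOp, mul_sum, ← sum_sub_distrib,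
      sum_eq_sum_ite ((minElems_subset _).trans (erase_subset x S))]
    refine sum_congr rfl fun y _ => ?_
    by_cases hy : y ∈ minElems (S.erase x)
    swap
    · simp [F, hy]
    -- Here `3 ≤ S.card` enters: the left side can be expanded by a third element only if one is
    -- left.
    have hne : ((S.erase x).erase y).Nonempty := by
      rw [← card_pos, card_erase_of_mem (minElems_subset _ hy),
        card_erase_of_mem (minElems_subset _ hx)]
      omega
    rw [if_pos hy, linkOp, extCount_eq_sum hne, mul_sum, sum_mul, mul_sum, ← sum_sub_distrib,
      sum_eq_sum_ite ((minElems_subset _).trans ((erase_subset y _).trans (erase_subset x S)))]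
    refine sum_congr rfl fun z _ => ?_
    by_cases hz : z ∈ minElems ((S.erase x).erase y)
    · simp only [F, D, hx, hy, hz, and_self, if_true]; ring
    · simp [F, hz]
  rw [← sub_nonneg, hF]
  refine sum_triple_nonneg S F fun x y z => ?_
  have hself := self_notMem_minElems_erase S
  have hself1 := self_notMem_minElems_erase_erase S
  have hself2 : ∀ u v, u ∉ minElems ((S.erase v).erase u) :=
    fun u v => self_notMem_minElems_erase (S.erase v) u
  by_cases hxy : x = y
  · subst hxy; simp [F, hself, hself1, hself2]
  by_cases hxz : x = z
  · subst hxz; simp [F, hself, hself1, hself2]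
  by_cases hyz : y = z
  · subst hyz; simp [F, hself, hself1, hself2]
  have himp : ∀ u v w, u ≠ v → u ≠ w → v ≠ w →
      (u ∈ minElems S → u ∈ minElems (S.erase v) ∧ u ∈ minElems (S.erase w)) ∧
      (u ∈ minElems (S.erase v) → u ∈ minElems ((S.erase v).erase w)) ∧
      (u ∈ minElems (S.erase w) → u ∈ minElems ((S.erase v).erase w)) ∧
      (u ∈ minElems (S.erase v) → u ∈ minElems (S.erase w) → u ∈ minElems S) := by
    intro u v w huv huw hvw
    refine ⟨fun h => ⟨mem_minElems_erase huv h, mem_minElems_erase huw h⟩,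
      mem_minElems_erase huw, fun h => ?_, mem_minElems_of_erase_erase hvw⟩
    rw [erase_right_comm]
    exact mem_minElems_erase huv h
  have key := perm_sum_nonneg _ _ _ _ _ _ _ _ _ _ _ _ (f x) (f y) (f z)
    (himp x y z hxy hxz hyz) (himp y x z (Ne.symm hxy) hyz hxz)
    (himp z x y (Ne.symm hxz) (Ne.symm hyz) hxy)
  have key2 := mul_nonneg (extCount_nonneg (((S.erase x).erase y).erase z)) key
  refine key2.trans_eq ?_
  have s1 : (S.erase y).erase x = (S.erase x).erase y := erase_right_comm
  have s2 : (S.erase z).erase x = (S.erase x).erase z := erase_right_comm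
  have s3 : (S.erase z).erase y = (S.erase y).erase z := erase_right_comm
  have s4 : ((S.erase x).erase z).erase y = ((S.erase x).erase y).erase z := erase_right_comm
  have s5 : ((S.erase y).erase z).erase x = ((S.erase x).erase y).erase z := by
    rw [erase_right_comm, s1]
  simp only [F, D, contract, s1, s2, s3, s4, s5, mul_add, mul_ite, mul_zero]

/-- The matrix counting linear extensions of `S` by their first two elements. -/
noncomputable def linkMatrix (S : Finset X) : Matrix (minElems S) (minElems S) ℝ :=
  Matrix.of fun x y => if (x : X) = y
    then ∑ z ∈ minElems (S.erase x) \ minElems S, extCount ((S.erase x).erase z)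
    else extCount ((S.erase x).erase y)

/-- `contract` gives each newly minimal element the value at `x`, so exactly those terms collect on
the diagonal. -/
theorem linkMatrix_mulVec (S : Finset X) (f : X → ℝ) (x : minElems S) :
    (linkMatrix S).mulVec (fun i => f i) x = linkOp S f x := by
  have hx := x.2
  simp only [Matrix.mulVec, dotProduct, linkMatrix, Matrix.of_apply]
  rw [sum_coe_sort (minElems S) (fun y => (if (x : X) = y
    then ∑ z ∈ minElems (S.erase x) \ minElems S, extCount ((S.erase x).erase z)
    else extCount ((S.erase x).erase y)) * f y), ← add_sum_erase _ _ hx, linkOp,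
    ← sum_sdiff (s₁ := (minElems S).erase x) (s₂ := minElems (S.erase x))]
  · congr 1
    · rw [if_pos rfl, sum_mul]
      refine sum_congr ?_ fun z hz => ?_
      · ext z
        simp only [mem_sdiff, mem_erase]
        refine and_congr_right fun hz => ?_
        have : z ≠ x := fun h => self_notMem_minElems_erase S x (h ▸ hz)
        simp [this]
      · have hzx : z ≠ x := fun h => self_notMem_minElems_erase S x (h ▸ (mem_sdiff.1 hz).1)
        rw [contract, if_neg fun h => (mem_sdiff.1 hz).2 (mem_erase.2 ⟨hzx, h⟩)]
    · refine sum_congr rfl fun z hz => ?_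
      rw [if_neg (ne_of_mem_erase hz).symm, contract, if_pos (mem_of_mem_erase hz)]
  · exact fun z hz => mem_minElems_erase (ne_of_mem_erase hz) (mem_of_mem_erase hz)

theorem linkMatrix_isSymm (S : Finset X) : (linkMatrix S).IsSymm := by
  ext x y
  simp only [Matrix.transpose_apply, linkMatrix, Matrix.of_apply]
  by_cases h : (x : X) = y
  · rw [if_pos h, if_pos h.symm, h]
  · rw [if_neg h, if_neg (Ne.symm h), erase_right_comm]

theorem linkMatrix_nonneg (S : Finset X) (x y : minElems S) : 0 ≤ linkMatrix S x y := by
  simp only [linkMatrix, Matrix.of_apply]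
  split_ifs
  · exact sum_nonneg fun _ _ => extCount_nonneg _
  · exact extCount_nonneg _

theorem linkMatrix_pos (S : Finset X) (x y : minElems S) (h : x ≠ y) : 0 < linkMatrix S x y := by
  simp only [linkMatrix, Matrix.of_apply]
  rw [if_neg fun h' => h (Subtype.ext h')]
  exact extCount_pos _

theorem linkOp_one {S : Finset X} {x : X} (h : (S.erase x).Nonempty) :
    linkOp S (fun _ => 1) x = extCount (S.erase x) := by
  simp [linkOp, contract, extCount_eq_sum h]

theorem linkForm_le_of_card_eq_two {S : Finset X} (hS : S.card = 2) (f : X → ℝ) :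
    linkForm S f ≤ ∑ x ∈ minElems S, linkOp S f x ^ 2 / extCount (S.erase x) := by
  obtain ⟨a, b, hab, rfl⟩ := card_eq_two.1 hS
  have ea : ({a, b} : Finset X).erase a = {b} := by
    ext u; simp only [mem_erase, mem_insert, mem_singleton]; grind
  have eb : ({a, b} : Finset X).erase b = {a} := by
    ext u; simp only [mem_erase, mem_insert, mem_singleton]; grind
  rw [linkForm, sum_eq_sum_ite (minElems_subset _), sum_eq_sum_ite (minElems_subset _)]
  simp only [sum_pair hab, linkOp, ea, eb, minElems_singleton, sum_singleton, erase_singleton,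
    extCount_empty, extCount_singleton, contract, one_mul, div_one]
  split_ifs <;> nlinarith [sq_nonneg (f a - f b)]

theorem linkForm_mul_le_sq (S : Finset X) (hS : 2 ≤ S.card) (f : X → ℝ) :
    linkForm S f * extCount S ≤ (∑ x ∈ minElems S, extCount (S.erase x) * f x) ^ 2 := by
  induction S using Finset.strongInduction generalizing f with
  | H S ih =>
    have hne : S.Nonempty := card_pos.1 (by omega)
    have hpull : ∀ f : X → ℝ,
        linkForm S f ≤ ∑ x ∈ minElems S, linkOp S f x ^ 2 / extCount (S.erase x) := by
      intro f
      rcases hS.eq_or_lt with h2 | h3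
      · exact linkForm_le_of_card_eq_two h2.symm f
      · refine (linkForm_le_sum_contract h3 f).trans (sum_le_sum fun x hx => ?_)
        have hxS := minElems_subset S hx
        rw [le_div_iff₀ (extCount_pos _)]
        -- The linear term in the induction hypothesis for `S.erase x`, applied to the contracted
        -- function, is `linkOp S f x` by definition.
        exact ih _ (erase_ssubset hxS) (by rw [card_erase_of_mem hxS]; omega) _
    have hform : ∀ f : X → ℝ, ∑ i : minElems S, f i * ((linkMatrix S).mulVec fun i => f i) i
        = linkForm S f := by
      intro f
      simp_rw [linkMatrix_mulVec]
      exact sum_coe_sort (minElems S) fun x => f x * linkOp S f x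
    have hE : ∑ i : minElems S, extCount (S.erase i) = extCount S := by
      rw [extCount_eq_sum hne]
      exact sum_coe_sort (minElems S) fun x => extCount (S.erase x)
    have hrow : ∀ i : minElems S, ∑ j, linkMatrix S i j = extCount (S.erase i) := by
      intro i
      rw [← linkOp_one, ← linkMatrix_mulVec]
      · simp [Matrix.mulVec, dotProduct]
      · rw [← card_pos, card_erase_of_mem (minElems_subset _ i.2)]; omega
    have main := quadForm_mul_le_sq (linkMatrix S) (fun i => extCount (S.erase i))
      (linkMatrix_isSymm S) (linkMatrix_nonneg S) (linkMatrix_pos S) (fun i => extCount_pos _) hrow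
      (by
        intro g
        -- The default `0` is harmless: for minimal `x`, `linkOp S G x` reads `G` only on `minElems
        -- S`.
        let G : X → ℝ := fun y => if h : y ∈ minElems S then g ⟨y, h⟩ else 0
        have hG : g = fun i : minElems S => G i := by funext i; simp [G]
        rw [hG, hform G]
        simp_rw [linkMatrix_mulVec]
        rw [sum_coe_sort (minElems S) fun x => linkOp S G x ^ 2 / extCount (S.erase x)]
        exact hpull G)
      (by rw [hE]; exact extCount_pos S) (fun i => f i)
    rwa [hform, hE, sum_coe_sort (minElems S) fun x => extCount (S.erase x) * f x] at main

theorem extCount_mul_le {S : Finset X} {x y : X} (hxy : x ≠ y) (hx : x ∈ minElems S)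
    (hy : y ∈ minElems S) :
    extCount S * extCount ((S.erase x).erase y)
      ≤ 2 * (extCount (S.erase x) * extCount (S.erase y)) := by
  have hS : 2 ≤ S.card := by
    rw [← card_pair hxy]
    exact card_le_card (insert_subset (minElems_subset S hx)
      (singleton_subset_iff.2 (minElems_subset S hy)))
  set a := extCount (S.erase x) with ha
  set b := extCount (S.erase y) with hb
  set m := extCount ((S.erase x).erase y) with hm
  have hm' : extCount ((S.erase y).erase x) = m := by rw [erase_right_comm]
  have hapos : 0 < a := extCount_pos _
  have hbpos : 0 < b := extCount_pos _
  -- These weights make both terms of the linear functional equal to `a * b`. In the quadratic form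
  -- only the two off-diagonal terms, `a * b * m` each, are kept; the rest is nonnegative.
  let f : X → ℝ := fun z => if z = x then b else if z = y then a else 0
  have hf0 : ∀ z, 0 ≤ f z := fun z => by
    simp only [f]; split_ifs
    exacts [hbpos.le, hapos.le, le_rfl]
  have hfx : f x = b := by simp [f]
  have hfy : f y = a := by simp [f, hxy.symm]
  have hsub : ({x, y} : Finset X) ⊆ minElems S :=
    insert_subset hx (singleton_subset_iff.2 hy)
  have h1 := linkForm_mul_le_sq S hS f
  have h2 : ∑ z ∈ minElems S, extCount (S.erase z) * f z = 2 * (a * b) := by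
    rw [← sum_subset hsub, sum_pair hxy, hfx, hfy]
    · ring
    · intro z _ hz
      simp only [mem_insert, mem_singleton, not_or] at hz
      simp [f, hz.1, hz.2]
  have hop : ∀ u v, u ≠ v → v ∈ minElems S →
      extCount ((S.erase u).erase v) * f v ≤ linkOp S f u := by
    intro u v huv hv
    have hc : contract S u f v = f v := by simp [contract, hv]
    rw [← hc]
    refine single_le_sum (f := fun v => extCount ((S.erase u).erase v) * contract S u f v)
      (fun z _ => mul_nonneg (extCount_nonneg _) ?_) (mem_minElems_erase huv.symm hv)
    simp only [contract]; split_ifs <;> exact hf0 _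
  have hop0 : ∀ u, 0 ≤ linkOp S f u := fun u => sum_nonneg fun z _ =>
    mul_nonneg (extCount_nonneg _) (by simp only [contract]; split_ifs <;> exact hf0 _)
  have h3 : 2 * (a * b * m) ≤ linkForm S f := by
    calc 2 * (a * b * m) = f x * (m * f y) + f y * (m * f x) := by rw [hfx, hfy]; ring
      _ ≤ f x * linkOp S f x + f y * linkOp S f y :=
        add_le_add (mul_le_mul_of_nonneg_left (hop x y hxy hy) (hf0 x))
          (mul_le_mul_of_nonneg_left (hm' ▸ hop y x hxy.symm hx) (hf0 y))
      _ = ∑ z ∈ {x, y}, f z * linkOp S f z :=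
        (sum_pair (f := fun z => f z * linkOp S f z) hxy).symm
      _ ≤ linkForm S f :=
        sum_le_sum_of_subset_of_nonneg hsub fun z _ _ => mul_nonneg (hf0 z) (hop0 z)
  rw [h2] at h1
  have h4 : 2 * (a * b * m) * extCount S ≤ (2 * (a * b)) ^ 2 :=
    (mul_le_mul_of_nonneg_right h3 (extCount_nonneg S)).trans h1
  have hab : 0 < 2 * (a * b) := by positivity
  refine le_of_mul_le_mul_left ?_ hab
  linarith [h4]

end LinkForm

/-! ### Monotone maps to long chains, and the lower bound -/

open Filter Topology

/-- An injective monotone map is its image, a subset of the chain of size `Nat.card α`, together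
with the ranks of the values, which form a linear extension. -/
theorem card_monotone_injective (α : Type*) [PartialOrder α] [Finite α] (N : ℕ) :
    Nat.card {g : α → Fin N // Monotone g ∧ Function.Injective g}
      = numLinExt α * N.choose (Nat.card α) := by
  classical
  have := Fintype.ofFinite α
  have hch : N.choose (Nat.card α)
      = Nat.card (Finset.powersetCard (Nat.card α) (Finset.univ : Finset (Fin N))) := by
    simp
  rw [hch, numLinExt, ← Nat.card_prod]
  symm
  let Φ : LinExt α × (Finset.powersetCard (Nat.card α) (Finset.univ : Finset (Fin N))) →
      {g : α → Fin N // Monotone g ∧ Function.Injective g} := fun p =>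
    ⟨fun a => p.2.1.orderEmbOfFin (Finset.mem_powersetCard.1 p.2.2).2 (p.1.1 a),
      ((Finset.orderEmbOfFin _ _).strictMono.comp p.1.2).monotone,
      (Finset.orderEmbOfFin _ _).injective.comp p.1.1.injective⟩
  refine Nat.card_eq_of_bijective Φ ⟨?_, ?_⟩
  · rintro ⟨f, s, hs⟩ ⟨f', s', hs'⟩ h
    have h1 : ∀ a, s.orderEmbOfFin (Finset.mem_powersetCard.1 hs).2 (f.1 a)
        = s'.orderEmbOfFin (Finset.mem_powersetCard.1 hs').2 (f'.1 a) :=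
      fun a => congrFun (congrArg Subtype.val h) a
    have h2 : s = s' := by
      rw [← Finset.coe_inj, ← Finset.range_orderEmbOfFin s (Finset.mem_powersetCard.1 hs).2,
        ← Finset.range_orderEmbOfFin s' (Finset.mem_powersetCard.1 hs').2,
        ← f.1.surjective.range_comp, ← f'.1.surjective.range_comp]
      exact congrArg Set.range (funext h1)
    subst h2
    have h3 : f = f' := Subtype.ext (Equiv.ext fun a => (Finset.orderEmbOfFin _ _).injective (h1 a))
    rw [h3]
  · rintro ⟨g, hg, hinj⟩
    have hs : (Finset.univ.image g).card = Nat.card α := by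
      rw [Finset.card_image_of_injective _ hinj, Finset.card_univ, Nat.card_eq_fintype_card]
    let F : α → Fin (Nat.card α) := fun a =>
      ((Finset.univ.image g).orderIsoOfFin hs).symm
        ⟨g a, Finset.mem_image_of_mem g (Finset.mem_univ a)⟩
    have hF : Function.Injective F := fun a b hab =>
      hinj (Subtype.mk.inj (OrderIso.injective _ hab))
    have hF' : Function.Bijective F :=
      (Fintype.bijective_iff_injective_and_card F).2 ⟨hF, by simp⟩
    refine ⟨⟨⟨Equiv.ofBijective F hF', fun a b hab => ?_⟩, Finset.univ.image g,
      Finset.mem_powersetCard.2 ⟨Finset.subset_univ _, hs⟩⟩, ?_⟩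
    · refine ((Finset.univ.image g).orderIsoOfFin hs).symm.strictMono (show (⟨g a, _⟩ : Finset.univ.image g) < ⟨g b, _⟩ from
        lt_of_le_of_ne (hg hab.le) fun h => hab.ne (hinj (Subtype.mk.inj h)))
    · refine Subtype.ext (funext fun a => ?_)
      simp only [Φ, Equiv.ofBijective_apply, F]
      rw [← Finset.coe_orderIsoOfFin_apply, OrderIso.apply_symm_apply]

theorem tendsto_card_monotone (α : Type*) [PartialOrder α] [Finite α] :
    Tendsto (fun N : ℕ => (Nat.card {g : α → Fin N // Monotone g} : ℝ) / (N : ℝ) ^ Nat.card α)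
      atTop (𝓝 ((numLinExt α : ℝ) / (Nat.card α).factorial)) := by
  classical
  have := Fintype.ofFinite α
  set n := Nat.card α with hn
  have hlow : ∀ N : ℕ, numLinExt α * N.choose n ≤ Nat.card {g : α → Fin N // Monotone g} := by
    intro N
    rw [← card_monotone_injective]
    exact Nat.card_le_card_of_injective (fun g => ⟨g.1, g.2.1⟩)
      fun g h e => Subtype.ext (Subtype.mk.inj e)
  -- Inclusion-exclusion: the union of the monotone and the injective maps lies among all `N ^ n`
  -- maps. Non-injective maps are asymptotically negligible, so the two bounds meet.
  have hup : ∀ N : ℕ, Nat.card {g : α → Fin N // Monotone g} + N.descFactorial n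
      ≤ numLinExt α * N.choose n + N ^ n := by
    intro N
    have h1 : N.descFactorial n = Nat.card {g : α → Fin N // Function.Injective g} := by
      rw [Nat.card_congr (Equiv.subtypeInjectiveEquivEmbedding α (Fin N)),
        Nat.card_eq_fintype_card, Fintype.card_embedding_eq, hn, Nat.card_eq_fintype_card,
        Fintype.card_fin]
    have h2 : N ^ n = Nat.card (α → Fin N) := by
      rw [Nat.card_fun, Nat.card_fin]
    rw [← card_monotone_injective, h1, h2]
    simp only [Nat.card_eq_fintype_card, Fintype.card_subtype]
    rw [Finset.filter_and, ← Finset.card_union_add_card_inter, add_comm]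
    exact Nat.add_le_add_left (Finset.card_le_univ _) _
  have hch : Tendsto (fun N : ℕ => (N.choose n : ℝ) / (N : ℝ) ^ n) atTop
      (𝓝 (1 / n.factorial)) := by
    have h := isEquivalent_choose n
    have hz : ∀ᶠ N : ℕ in atTop, ((N : ℝ) ^ n / n.factorial) ≠ 0 := by
      filter_upwards [eventually_gt_atTop 0] with N hN
      positivity
    rw [Asymptotics.isEquivalent_iff_tendsto_one hz] at h
    have h' := h.mul_const (1 / (n.factorial : ℝ))
    rw [one_mul] at h'
    refine h'.congr' ?_
    filter_upwards [eventually_gt_atTop 0] with N hN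
    simp only [Pi.div_apply]
    have : (n.factorial : ℝ) ≠ 0 := by positivity
    field_simp
  have hdf : Tendsto (fun N : ℕ => (N.descFactorial n : ℝ) / (N : ℝ) ^ n) atTop (𝓝 1) := by
    have h := isEquivalent_descFactorial n
    have hz : ∀ᶠ N : ℕ in atTop, ((N : ℝ) ^ n) ≠ 0 := by
      filter_upwards [eventually_gt_atTop 0] with N hN
      positivity
    rw [Asymptotics.isEquivalent_iff_tendsto_one hz] at h
    exact h
  have hL := hch.const_mul (numLinExt α : ℝ)
  have hU := (hL.add_const 1).sub hdf
  rw [mul_one_div] at hL hU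
  rw [add_sub_cancel_right] at hU
  refine tendsto_of_tendsto_of_tendsto_of_le_of_le' hL hU ?_ ?_
  · filter_upwards [eventually_gt_atTop 0] with N hN
    rw [← mul_div_assoc]
    have : ((numLinExt α * N.choose n : ℕ) : ℝ) ≤ _ := Nat.cast_le.2 (hlow N)
    push_cast at this
    gcongr
  · filter_upwards [eventually_gt_atTop 0] with N hN
    have h1 : ((_ + _ : ℕ) : ℝ) ≤ ((_ + _ : ℕ) : ℝ) := Nat.cast_le.2 (hup N)
    push_cast at h1
    have hp : (0 : ℝ) < (N : ℝ) ^ n := by positivity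
    have h2 : (numLinExt α : ℝ) * ((N.choose n : ℝ) / (N : ℝ) ^ n) + 1
        - (N.descFactorial n : ℝ) / (N : ℝ) ^ n
        = ((numLinExt α : ℝ) * (N.choose n : ℝ) + (N : ℝ) ^ n - N.descFactorial n)
          / (N : ℝ) ^ n := by
      field_simp
    rw [h2]
    gcongr
    linarith

/-- The number of maps to a chain that are monotone on a subposet. -/
theorem card_monotoneOn {X : Type*} [PartialOrder X] [Finite X] (p : X → Prop) (N : ℕ) :
    Nat.card {g : X → Fin N // Monotone fun z : {z // p z} => g z}
      = Nat.card {g : {z // p z} → Fin N // Monotone g} * N ^ Nat.card {z // ¬ p z} := by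
  classical
  have h : N ^ Nat.card {z // ¬ p z} = Nat.card ({z // ¬ p z} → Fin N) := by
    rw [Nat.card_fun, Nat.card_fin]
  rw [h, ← Nat.card_prod]
  refine Nat.card_congr
    { toFun := fun g => (⟨fun z => g.1 z, g.2⟩, fun z => g.1 z)
      invFun := fun q => ⟨fun z => if hz : p z then q.1.1 ⟨z, hz⟩ else q.2 ⟨z, hz⟩, ?_⟩
      left_inv := ?_
      right_inv := ?_ }
  · intro a b hab
    simp only [a.2, b.2, dif_pos]
    exact q.1.2 hab
  · intro g
    ext z
    simp
  · intro q
    refine Prod.ext (Subtype.ext (funext fun z => ?_)) (funext fun z => ?_)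
    · simp [z.2]
    · simp [z.2]

theorem tendsto_card_monotoneOn {X : Type*} [PartialOrder X] [Finite X] (p : X → Prop) :
    Tendsto (fun N : ℕ => (Nat.card {g : X → Fin N // Monotone fun z : {z // p z} => g z} : ℝ)
        / (N : ℝ) ^ Nat.card X)
      atTop (𝓝 ((numLinExt {z // p z} : ℝ) / (Nat.card {z // p z}).factorial)) := by
  classical
  have := Fintype.ofFinite X
  refine (tendsto_card_monotone {z // p z}).congr' ?_
  filter_upwards [eventually_gt_atTop 0] with N hN
  have hc : Nat.card X = Nat.card {z // p z} + Nat.card {z // ¬ p z} := by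
    rw [← Nat.card_sum, Nat.card_congr (Equiv.sumCompl p)]
  rw [card_monotoneOn, hc, pow_add]
  push_cast
  have : (N : ℝ) ^ Nat.card {z // ¬ p z} ≠ 0 := by positivity
  rw [mul_div_mul_right _ _ this]

/-- Correlation of the constraints imposed by two minimal elements on random maps to a chain. -/
theorem card_monotoneOn_mul_le {X : Type*} [PartialOrder X] [Finite X] {x y : X} (hxy : x ≠ y)
    (hx : IsMin x) (hy : IsMin y) (N : ℕ) :
    Nat.card {g : X → Fin N // Monotone fun z : {z // z ≠ x} => g z}
        * Nat.card {g : X → Fin N // Monotone fun z : {z // z ≠ y} => g z}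
      ≤ Nat.card {g : X → Fin N // Monotone fun z : {z // z ≠ x ∧ z ≠ y} => g z}
        * Nat.card {g : X → Fin N // Monotone g} := by
  classical
  have := Fintype.ofFinite X
  -- Raising values above `x` helps its constraint while raising the value at `x` hurts it.
  -- Reversing the coordinates `x` and `y` makes both constraints increasing.
  let rv : (X → Fin N) → X → Fin N := fun g z => if z = x ∨ z = y then (g z).rev else g z
  have hrv : Function.Involutive rv := by
    intro g; funext z; simp only [rv]; split_ifs <;> simp
  have hcard : ∀ p : (X → Fin N) → Prop,
      Nat.card {g : X → Fin N // p g} = ∑ g : X → Fin N, if p (rv g) then 1 else 0 := by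
    intro p
    rw [← Nat.card_congr (hrv.toPerm.subtypeEquiv (p := fun g => p (rv g)) (q := p)
      fun g => Iff.rfl), Nat.card_eq_fintype_card, Fintype.card_subtype, Finset.sum_boole]
    rfl
  have hrvQ : ∀ g z, z ≠ x ∧ z ≠ y → rv g z = g z := fun g z hz => by
    simp [rv, hz.1, hz.2]
  have hrvx : ∀ g, rv g x = (g x).rev := fun g => by simp [rv]
  have hrvy : ∀ g, rv g y = (g y).rev := fun g => by simp [rv]
  let Q : (X → Fin N) → Prop := fun g => Monotone fun z : {z // z ≠ x ∧ z ≠ y} => g z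
  let U : X → (X → Fin N) → Prop := fun w g => ∀ z, w < z → (g w).rev ≤ g z
  have hUmono : ∀ w, ∀ g h : X → Fin N, g ≤ h → U w g → U w h := fun w g h hgh hg z hz =>
    (Fin.rev_le_rev.2 (hgh w)).trans ((hg z hz).trans (hgh z))
  have hlt : ∀ {z w : X}, (w = x ∨ w = y) → w < z → z ≠ x ∧ z ≠ y := fun {z w} _ h =>
    ⟨fun e => hx.not_lt (e ▸ h), fun e => hy.not_lt (e ▸ h)⟩
  have hU : ∀ w, (w = x ∨ w = y) → ∀ g, U w g ↔ ∀ z, w < z → rv g w ≤ rv g z := by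
    intro w hw g
    refine forall₂_congr fun z hz => ?_
    rw [hrvQ g z (hlt hw hz)]
    rcases hw with rfl | rfl
    · rw [hrvx]
    · rw [hrvy]
  have hQ : ∀ g, Q g ↔ ∀ a b, a ≠ x → a ≠ y → a ≤ b → rv g a ≤ rv g b := by
    intro g
    constructor
    · intro h a b hax hay hab
      have hb : b ≠ x ∧ b ≠ y :=
        ⟨fun e => hax (hx.eq_of_le (e ▸ hab)), fun e => hay (hy.eq_of_le (e ▸ hab))⟩
      rw [hrvQ g a ⟨hax, hay⟩, hrvQ g b hb]
      exact @h ⟨a, hax, hay⟩ ⟨b, hb⟩ hab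
    · intro h a b hab
      have := h a b a.2.1 a.2.2 hab
      rwa [hrvQ g a a.2, hrvQ g b b.2] at this
  have eQ : ∀ g, (Monotone fun z : {z // z ≠ x ∧ z ≠ y} => rv g z) ↔ Q g := by
    intro g
    have : (fun z : {z // z ≠ x ∧ z ≠ y} => rv g z) =
        fun z : {z // z ≠ x ∧ z ≠ y} => g z :=
      funext fun z => hrvQ g z z.2
    rw [this]
  have ey : ∀ g, (Monotone fun z : {z // z ≠ x} => rv g z) ↔ Q g ∧ U y g := by
    intro g
    rw [hQ, hU y (Or.inr rfl)]
    constructor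
    · intro h
      refine ⟨fun a b hax hay hab => @h ⟨a, hax⟩ ⟨b, fun e => hax (hx.eq_of_le (e ▸ hab))⟩ hab,
        fun z hz => @h ⟨y, hxy.symm⟩ ⟨z, (hlt (Or.inr rfl) hz).1⟩ hz.le⟩
    · rintro ⟨h1, h2⟩ ⟨a, ha⟩ ⟨b, hb⟩ hab
      by_cases hay : a = y
      · subst hay
        rcases eq_or_lt_of_le (show a ≤ b from hab) with e | e
        · simp [e]
        · exact h2 b e
      · exact h1 a b ha hay hab
  have ex : ∀ g, (Monotone fun z : {z // z ≠ y} => rv g z) ↔ Q g ∧ U x g := by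
    intro g
    rw [hQ, hU x (Or.inl rfl)]
    constructor
    · intro h
      refine ⟨fun a b hax hay hab => @h ⟨a, hay⟩ ⟨b, fun e => hay (hy.eq_of_le (e ▸ hab))⟩ hab,
        fun z hz => @h ⟨x, hxy⟩ ⟨z, (hlt (Or.inl rfl) hz).2⟩ hz.le⟩
    · rintro ⟨h1, h2⟩ ⟨a, ha⟩ ⟨b, hb⟩ hab
      by_cases hax : a = x
      · subst hax
        rcases eq_or_lt_of_le (show a ≤ b from hab) with e | e
        · simp [e]
        · exact h2 b e
      · exact h1 a b hax ha hab
  have exy : ∀ g, Monotone (rv g) ↔ Q g ∧ (U y g ∧ U x g) := by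
    intro g
    rw [hQ, hU x (Or.inl rfl), hU y (Or.inr rfl)]
    constructor
    · exact fun h => ⟨fun a b _ _ hab => h hab, fun z hz => h hz.le, fun z hz => h hz.le⟩
    · rintro ⟨h1, h2, h3⟩ a b hab
      rcases eq_or_lt_of_le hab with e | e
      · rw [e]
      by_cases hax : a = x
      · exact hax ▸ h3 b (hax ▸ e)
      by_cases hay : a = y
      · exact hay ▸ h2 b (hay ▸ e)
      exact h1 a b hax hay hab
  rw [hcard, hcard, hcard, hcard]
  simp only [eQ, ex, ey, exy]
  let μ : (X → Fin N) → ℕ := fun g => if Q g then 1 else 0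
  let F : X → (X → Fin N) → ℕ := fun w g => if U w g then 1 else 0
  have hFm : ∀ w, Monotone (F w) := by
    intro w g h hgh
    simp only [F]
    split_ifs with h1 h2
    · exact le_rfl
    · exact absurd (hUmono w g h hgh h1) h2
    · exact Nat.zero_le _
    · exact le_rfl
  have key := fkg (α := X → Fin N) (μ := μ) (f := F y) (g := F x)
    (fun _ => Nat.zero_le _) (fun _ => Nat.zero_le _) (fun _ => Nat.zero_le _)
    (hFm y) (hFm x) (by
      intro a b
      by_cases ha : Q a
      swap
      · simp [μ, ha]
      by_cases hb : Q b
      swap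
      · simp [μ, hb]
      -- Maps monotone off `x` and `y` form a sublattice, so their indicator is log-supermodular as
      -- FKG requires.
      have h1 : Q (a ⊓ b) := fun u v huv => inf_le_inf (ha huv) (hb huv)
      have h2 : Q (a ⊔ b) := fun u v huv => sup_le_sup (ha huv) (hb huv)
      simp [μ, ha, hb, h1, h2])
  have hmul : ∀ (p q : Prop) [Decidable p] [Decidable q],
      (if p ∧ q then 1 else 0 : ℕ) = (if p then 1 else 0) * (if q then 1 else 0) := by
    intro p q _ _; by_cases hp : p <;> by_cases hq : q <;> simp [hp, hq]
  simp only [hmul]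
  exact key

/-- In the limit the counts become `e(Q) / |Q|!`, and `(n+1)!² / (n! (n+2)!) = (n+1) / (n+2)`. Here
`n` is the size after removing both elements. -/
theorem numLinExt_mul_mul_le {X : Type*} [PartialOrder X] [Finite X] {n : ℕ}
    (hcard : Nat.card X = n + 2) {x y : X} (hxy : x ≠ y) (hx : IsMin x) (hy : IsMin y) :
    ((n : ℝ) + 2) * ((numLinExt {z // z ≠ x} : ℝ) * numLinExt {z // z ≠ y})
      ≤ ((n : ℝ) + 1) * ((numLinExt X : ℝ) * numLinExt {z // z ≠ x ∧ z ≠ y}) := by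
  classical
  have := Fintype.ofFinite X
  have c1 : ∀ w : X, Nat.card {z // z ≠ w} = n + 1 := by
    intro w
    rw [Nat.card_eq_fintype_card] at *
    rw [Fintype.card_subtype_compl, Fintype.card_subtype_eq, hcard]; rfl
  have c2 : Nat.card {z // z ≠ x ∧ z ≠ y} = n := by
    have h : (Finset.univ.filter fun z => z ≠ x ∧ z ≠ y) = (Finset.univ.erase x).erase y := by
      ext z; simp [and_comm]
    rw [Nat.card_eq_fintype_card] at *
    rw [Fintype.card_subtype, h, Finset.card_erase_of_mem (by simp [hxy.symm]),
      Finset.card_erase_of_mem (Finset.mem_univ x), Finset.card_univ, hcard]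
    rfl
  have t1 := tendsto_card_monotoneOn fun z => z ≠ x
  have t2 := tendsto_card_monotoneOn fun z => z ≠ y
  have t3 := tendsto_card_monotoneOn fun z => z ≠ x ∧ z ≠ y
  have t4 := tendsto_card_monotone X
  have h := le_of_tendsto_of_tendsto' (t1.mul t2) (t3.mul t4) (fun N => by
    rw [div_mul_div_comm, div_mul_div_comm]
    have := card_monotoneOn_mul_le hxy hx hy N
    exact div_le_div_of_nonneg_right (by exact_mod_cast this) (by positivity))
  rw [c1, c1, c2, hcard, div_mul_div_comm, div_mul_div_comm, div_le_div_iff₀ (by positivity)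
    (by positivity)] at h
  have f2 : ((n + 2).factorial : ℝ) = (n + 2) * ((n + 1) * n.factorial) := by
    rw [Nat.factorial_succ, Nat.factorial_succ]; push_cast; ring
  have f1 : ((n + 1).factorial : ℝ) = (n + 1) * n.factorial := by
    rw [Nat.factorial_succ]; push_cast; ring
  rw [f1, f2] at h
  have hp : (0 : ℝ) < (n + 1) * (n.factorial * n.factorial) := by positivity
  refine le_of_mul_le_mul_left ?_ hp
  linarith

theorem theorem1p1 {X : Type*} [PartialOrder X] [Finite X] (n : ℕ) (hcard : Nat.card X = n)
    (hn : 2 < n) (x y : X) (hxy : x ≠ y) (hx : IsMin x) (hy : IsMin y) :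
    (n : ℝ) / ((n : ℝ) - 1) ≤
        ((numLinExt X : ℝ) * (numLinExt {z : X // z ≠ x ∧ z ≠ y} : ℝ)) /
          ((numLinExt {z : X // z ≠ x} : ℝ) * (numLinExt {z : X // z ≠ y} : ℝ)) ∧
      ((numLinExt X : ℝ) * (numLinExt {z : X // z ≠ x ∧ z ≠ y} : ℝ)) /
          ((numLinExt {z : X // z ≠ x} : ℝ) * (numLinExt {z : X // z ≠ y} : ℝ)) ≤ 2 := by
  classical
  have := Fintype.ofFinite X
  have hsub : ∀ (p : X → Prop) (S : Finset X), (∀ z, p z ↔ z ∈ S) →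
      (numLinExt {z // p z} : ℝ) = extCount S := by
    intro p S h
    rw [extCount]
    congr 1
    exact numLinExt_congr
      { toEquiv := Equiv.subtypeEquivRight h
        map_rel_iff' := Iff.rfl }
  have e0 : (numLinExt X : ℝ) = extCount (Finset.univ : Finset X) := by
    rw [extCount]
    congr 1
    exact numLinExt_congr
      { toEquiv := (Equiv.subtypeUnivEquiv fun z => Finset.mem_univ z).symm
        map_rel_iff' := Iff.rfl }
  have ex : (numLinExt {z // z ≠ x} : ℝ) = extCount (Finset.univ.erase x) :=
    hsub _ _ fun z => by simp
  have ey : (numLinExt {z // z ≠ y} : ℝ) = extCount (Finset.univ.erase y) :=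
    hsub _ _ fun z => by simp
  have exy : (numLinExt {z // z ≠ x ∧ z ≠ y} : ℝ) = extCount ((Finset.univ.erase x).erase y) :=
    hsub _ _ fun z => by simp [and_comm]
  have hpos : (0 : ℝ) < (numLinExt {z // z ≠ x} : ℝ) * numLinExt {z // z ≠ y} := by
    rw [ex, ey]; exact mul_pos (extCount_pos _) (extCount_pos _)
  constructor
  · obtain ⟨m, rfl⟩ : ∃ m, n = m + 2 := ⟨n - 2, by omega⟩
    have h := numLinExt_mul_mul_le hcard hxy hx hy
    have h1 : ((m + 2 : ℕ) : ℝ) - 1 = m + 1 := by push_cast; ring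
    rw [h1, div_le_div_iff₀ (by positivity) hpos]
    push_cast
    linarith
  · rw [div_le_iff₀ hpos, e0, ex, ey, exy]
    have hmem : ∀ w : X, IsMin w → w ∈ minElems Finset.univ := fun w hw =>
      mem_minElems.2 ⟨Finset.mem_univ w, fun u _ => hw.not_lt⟩
    exact extCount_mul_le hxy (hmem x hx) (hmem y hy)
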